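/- Let $K$ be an oriented virtual knot diagram with classical crossings $v_1,\dots,v_n$, and let $X=\mathbb Z_2$ be the parity biquandle, $x\circ y=x*y=x+1$. Work over $R=\mathbb Z_2$ with $\delta=0$, $w=1$, and put, for $x,y\in X$, $$A_{x,y}=B_{x,y}=D_{x,y}=E_{x,y}=\begin{cases}1,&x=y\\0,&x\ne y\end{cases}\qquad C_{x,y}=F_{x,y}=\begin{cases}0,&x=y\\1,&x\neq y.\end{cases}$$ Let $\mathbb Z_2\mathfrak G_0$ be the $\mathbb Z_2$-vector space generated by the isomorphism classes of finite $4$-valent graphs with a cross structure (the four half-edges at each vertex are split into two pairs of opposite ones; circles without vertices are allowed as components), modulo the second Reidemeister move and $G\sqcup\bigcirc=0$ for non-empty $G$. *Parity-biquandle bracket.* An $X$-colouring $f$ of $K$ colours the edges of $K$ by elements of $X$ such that at each classical crossing, drawn with both strands running downwards, the upper and lower left edges (at a negative crossing: the lower and upper left edges) have colours $x$ and $y$ and, on the right, the other edge of the strand coloured $x$ has colour $x\circ y$ and the other edge of the strand coloured $y$ has colour $y*x$; in either case $x$ lies on the lower (undercrossing) strand. A state chooses at each classical crossing the orientation-respecting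 smoothing, the other smoothing, or the graphical vertex, with coefficient $A_{x,y},B_{x,y},C_{x,y}$ respectively at a positive and $D_{x,y},E_{x,y},F_{x,y}$ at a negative crossing. The value $\beta(f)_{gr}\in \mathbb Z_2\mathfrak G_0$ is $w^{-\mathrm{wr}(K)}$ times the sum over the $3^n$ states of the product of the coefficients times the resulting graph, and $\Phi^{\beta,M}_{X,gr}(K)$ is the multiset of the values $\beta(f)_{gr}$ over all $X$-colourings $f$ of $K$. *Parity bracket.* Let $p(v)\in\mathbb Z_2$ be the Gaussian parity of $v$, that is, the number modulo $2$ of chords of the Gauss diagram of $K$ linked with the chord of $v$. Then $$[K]=\sum_{s\in\{0,1\}^n}\ \prod_{i=1}^n q_s(v_i)\,K_s\in\mathbb Z_2\mathfrak G_0,$$ where $q_s(v_i)=p(v_i)$ if $s_i=0$ and $q_s(v_i)=1-p(v_i)$ if $s_i=1$, and $K_s$ is the sum of all graphs obtained from $K$ by smoothing, in one of the two ways, every $v_i$ with $s_i=1$ and keeping every $v_i$ with $s_i=0$ as a vertex. Then: 1. $\beta=(A,B,C,D,E,F)$ with $\delta=0$, $w=1$ satisfies the defining relations of a parity-biquandle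 bracket for $X$ over $\mathbb Z_2$, that is, for all $x,y,z\in X$: (i) $\delta A_{x,x}+B_{x,x}=w$, $\delta D_{x,x}+E_{x,x}=w^{-1}$, $C_{x,x}=F_{x,x}=0$; (ii) $A_{x,y}F_{x,y}=C_{x,y}D_{x,y}=B_{x,y}F_{x,y}=C_{x,y}E_{x,y}=0$, $A_{x,y}D_{x,y}=B_{x,y}E_{x,y}=1-C_{x,y}F_{x,y}$, $\delta A_{x,y}D_{x,y}=-A_{x,y}E_{x,y}-B_{x,y}D_{x,y}$; (iii) writing $\ell(PQS)=P_{x,y}Q_{y,z}S_{x\circ y,z*y}$ and $r(PQS)=P_{x,z}Q_{y*x,z*x}S_{x\circ z,y\circ z}$ for $P,Q,S\in\{A,B,C\}$, $$\begin{gathered} \ell(AAA)+\ell(CCA)=r(AAA)+r(ACC),\quad \ell(ABB)+\ell(CBC)=r(BBA)+r(CBC),\\ \ell(BAB)+\ell(BCC)=r(BAB)+r(CCB),\quad \ell(ACA)+\ell(CAA)=r(CAA),\\ \ell(AAC)=r(AAC)+r(ACA),\quad \ell(ACB)=r(BBC)+r(CBA),\\ \ell(BCB)+\ell(BAC)=r(BAC),\quad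 \ell(ABC)+\ell(CBB)=r(BCA),\quad \ell(CAB)=r(BCB)+r(CAB),\\ \ell(CCB)=r(BCC),\quad \ell(ACC)=r(CCA),\quad \ell(CAC)=r(CAC),\\ \ell(BCA)=\ell(CBA)=\ell(BBC)=\ell(CCC)=0,\quad r(ABC)=r(ACB)=r(CBB)=r(CCC)=0,\\ \ell(AAB)=r(ABA)+r(AAB)+\delta\, r(ABB)+r(BBB),\\ r(BAA)=\ell(BAA)+\ell(ABA)+\delta\,\ell(BBA)+\ell(BBB). \end{gathered}$$ 2. For every virtual knot diagram $K$, the multiset $\Phi^{\beta,M}_{X,gr}(K)$ consists of the parity bracket $[K]$ taken exactly twice, and of nothing else. -/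

import Mathlib

namespace ParityBiquandle

/-! ### Framed 4-graphs -/

/-- The four half-edges at a 4-valent vertex, split into two pairs by the first coordinate. -/
abbrev Corner : Type := Bool × Bool

/-- The half-edge opposite to a given one (the other member of its pair). -/
def Corner.opp (c : Corner) : Corner := (c.1, !c.2)

/-- A 4-valent graph with a cross structure (a framed 4-graph), possibly with circle components
without vertices. The half-edges at the vertex `v` are the `(v, c)` with `c : Corner`, and `(v, c)`
is opposite to `(v, c.opp)`; `att` sends a half-edge to the edge containing it. An edge contains
either two half-edges (an honest edge or loop) or none (a circle without vertices). -/
structure FramedGraph : Type 1 where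
  V : Type
  E : Type
  finV : Finite V
  finE : Finite E
  att : V × Corner → E
  att_ncard : ∀ e : E, {h : V × Corner | att h = e}.ncard = 0 ∨ {h | att h = e}.ncard = 2

attribute [instance] FramedGraph.finV FramedGraph.finE

/-- The three ways to join the four half-edges at a vertex in pairs. -/
inductive Pairing : Type
  | through
  | parallel
  | turning

/-- The half-edge joined to a given one. `through` joins opposite half-edges, so that the two strands
just pass each other and the vertex disappears; the other two are the smoothings of the vertex. -/
def Pairing.partner : Pairing → Corner → Corner
  | .through, c => (c.1, !c.2)
  | .parallel, c => (!c.1, !c.2)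
  | .turning, c => (!c.1, c.2)

theorem Pairing.partner_partner (π : Pairing) (c : Corner) : π.partner (π.partner c) = c := by
  cases π <;> simp [Pairing.partner]

theorem Pairing.partner_ne (π : Pairing) (c : Corner) : π.partner c ≠ c := by
  rcases c with ⟨a, b⟩
  cases π <;> cases a <;> cases b <;> simp [Pairing.partner]

namespace FramedGraph

/-- Two edges are glued directly when a removed vertex joins a half-edge of the first one
to a half-edge of the second one. -/
def Glue (G : FramedGraph) (ρ : G.V → Option Pairing) (e e' : G.E) : Prop :=
  ∃ (v : G.V) (π : Pairing) (c : Corner),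
    ρ v = some π ∧ G.att (v, c) = e ∧ G.att (v, π.partner c) = e'

open Classical in
theorem resolve_ncard (G : FramedGraph) (ρ : G.V → Option Pairing) (q : Quot (G.Glue ρ)) :
    {h : {v : G.V // ρ v = none} × Corner | Quot.mk (G.Glue ρ) (G.att (h.1.1, h.2)) = q}.ncard = 0 ∨
    {h : {v : G.V // ρ v = none} × Corner |
      Quot.mk (G.Glue ρ) (G.att (h.1.1, h.2)) = q}.ncard = 2 := by
  have := Fintype.ofFinite G.V
  have := Fintype.ofFinite G.E
  let m : G.E → Quot (G.Glue ρ) := Quot.mk _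
  -- Half-edges in the class, those of them at removed vertices, and the others.
  let Hc : Finset (G.V × Corner) := Finset.univ.filter fun h => m (G.att h) = q
  let Sc : Finset (G.V × Corner) := Hc.filter fun h => ρ h.1 ≠ none
  let Rc : Finset (G.V × Corner) := Hc.filter fun h => ¬ ρ h.1 ≠ none
  have hsum : Sc.card + Rc.card = Hc.card := Finset.card_filter_add_card_filter_not _
  have htarget : {h : {v : G.V // ρ v = none} × Corner |
      Quot.mk (G.Glue ρ) (G.att (h.1.1, h.2)) = q}.ncard = Rc.card := by
    rw [← Set.ncard_coe_finset Rc]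
    refine Set.ncard_congr (fun h _ => (h.1.1, h.2)) ?_ ?_ ?_
    · rintro ⟨⟨v, hv⟩, c⟩ h
      simpa [Rc, Hc, hv, m] using h
    · rintro ⟨⟨v, hv⟩, c⟩ ⟨⟨v', hv'⟩, c'⟩ _ _ h
      simpa using h
    · rintro ⟨v, c⟩ h
      simp only [Rc, Hc, Finset.coe_filter, Finset.mem_filter, Set.mem_ofPred_eq] at h
      exact ⟨(⟨v, by simpa using h.2⟩, c), h.1.2, rfl⟩
  -- The pairing of the half-edges at removed vertices.
  let τ : G.V × Corner → G.V × Corner := fun h =>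
    match ρ h.1 with
    | none => h
    | some π => (h.1, π.partner h.2)
  have τ_some : ∀ v c π, ρ v = some π → τ (v, c) = (v, π.partner c) := by
    intro v c π h
    simp only [τ, h]
  have mem_Sc : ∀ h, h ∈ Sc ↔ m (G.att h) = q ∧ ∃ π, ρ h.1 = some π := by
    intro h
    simp [Sc, Hc, Option.ne_none_iff_exists']
  have τ_mem : ∀ h ∈ Sc, τ h ∈ Sc := by
    rintro ⟨v, c⟩ h
    obtain ⟨h1, π, h2⟩ := (mem_Sc _).1 h
    rw [mem_Sc, τ_some v c π h2]
    refine ⟨?_, π, h2⟩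
    rw [← h1]
    exact (Quot.sound ⟨v, π, c, h2, rfl, rfl⟩).symm
  have evenS : Even Sc.card := by
    have : ((Sc.card : ℕ) : ZMod 2) = 0 := by
      have : ∑ _h ∈ Sc, (1 : ZMod 2) = 0 := by
        refine Finset.sum_involution (fun h _ => τ h) ?_ ?_ τ_mem ?_
        · intro _ _; decide
        · rintro ⟨v, c⟩ h _
          obtain ⟨h1, π, h2⟩ := (mem_Sc _).1 h
          rw [τ_some v c π h2]
          intro h3
          exact π.partner_ne c (Prod.ext_iff.1 h3).2
        · rintro ⟨v, c⟩ h
          obtain ⟨h1, π, h2⟩ := (mem_Sc _).1 h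
          rw [τ_some v c π h2, τ_some v _ π h2, π.partner_partner]
      simpa using this
    exact (ZMod.natCast_eq_zero_iff_even).1 this
  let Ec := {e : G.E // m e = q}
  have fib : ∀ e : Ec, (Hc.filter fun h => G.att h = e.1).card = 0 ∨
      (Hc.filter fun h => G.att h = e.1).card = 2 := by
    intro e
    have : ((Hc.filter fun h => G.att h = e.1 : Finset _) : Set (G.V × Corner)) =
        {h | G.att h = e.1} := by
      ext h
      simp only [Hc, Finset.coe_filter, Finset.mem_filter, Finset.mem_univ, true_and,
        Set.mem_ofPred_eq, and_iff_right_iff_imp]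
      intro h'
      rw [h', e.2]
    rw [← Set.ncard_coe_finset, this]
    exact G.att_ncard e.1
  have hH : Hc.card = ∑ e : Ec, (Hc.filter fun h => G.att h = e.1).card := by
    have h1 := Finset.card_eq_sum_card_fiberwise (s := Hc) (f := G.att)
      (t := Finset.univ.filter fun e => m e = q) (by intro h hh; simpa [Hc] using hh)
    rw [h1, Finset.sum_subtype (p := fun e => m e = q) _ (by simp)]
  have evenH : Even Hc.card := by
    rw [hH]
    refine Finset.even_sum _ fun e _ => ?_
    rcases fib e with h | h <;> simp [h]
  have leH : Hc.card ≤ 2 * Fintype.card Ec := by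
    rw [hH]
    refine (Finset.sum_le_card_nsmul Finset.univ _ 2 fun e _ => ?_).trans ?_
    · rcases fib e with h | h <;> simp [h]
    · simp [mul_comm]
  -- The edges of the class form a connected graph.
  let Γ : SimpleGraph Ec := SimpleGraph.fromRel fun e e' => G.Glue ρ e.1 e'.1
  have reach : ∀ e e' : G.E, Relation.EqvGen (G.Glue ρ) e e' →
      ∀ (h : m e = q) (h' : m e' = q), Γ.Reachable ⟨e, h⟩ ⟨e', h'⟩ := by
    intro e e' hee
    induction hee with
    | rel a b hab =>
      intro h h'
      by_cases hne : a = b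
      · subst hne; exact SimpleGraph.Reachable.refl _
      · exact SimpleGraph.Adj.reachable
          ((SimpleGraph.fromRel_adj _ _ _).2 ⟨fun h3 => hne (Subtype.ext_iff.1 h3), Or.inl hab⟩)
    | refl a => intro h h'; exact SimpleGraph.Reachable.refl _
    | symm a b _ ih => intro h h'; exact (ih h' h).symm
    | trans a b c hab _ ih1 ih2 =>
      intro h h'
      have hb : m b = q := (Quot.eqvGen_sound hab).symm.trans h
      exact (ih1 h hb).trans (ih2 hb h')
  have conn : Γ.Connected := by
    have : Nonempty Ec := by
      obtain ⟨e, he⟩ := Quot.exists_rep q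
      exact ⟨⟨e, he⟩⟩
    refine ⟨fun e e' => reach _ _ ?_ e.2 e'.2⟩
    exact Quot.eqvGen_exact (e.2.trans e'.2.symm)
  have hdart : ∀ d : Γ.Dart, ∃ h ∈ Sc, G.att h = d.fst.1 ∧ G.att (τ h) = d.snd.1 := by
    intro d
    rcases ((SimpleGraph.fromRel_adj _ _ _).1 d.adj).2 with h | h
    · obtain ⟨v, π, c, h1, h2, h3⟩ := h
      refine ⟨(v, c), (mem_Sc _).2 ⟨?_, π, h1⟩, h2, ?_⟩
      · rw [h2, d.fst.2]
      · rw [τ_some v c π h1, h3]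
    · obtain ⟨v, π, c, h1, h2, h3⟩ := h
      refine ⟨(v, π.partner c), (mem_Sc _).2 ⟨?_, π, h1⟩, h3, ?_⟩
      · rw [h3, d.fst.2]
      · rw [τ_some v _ π h1, π.partner_partner, h2]
  choose k hk1 hk2 hk3 using hdart
  have hdS : Fintype.card Γ.Dart ≤ Sc.card := by
    rw [← Fintype.card_coe Sc]
    refine Fintype.card_le_of_injective (fun d => ⟨k d, hk1 d⟩) fun d d' h => ?_
    have h' : k d = k d' := Subtype.ext_iff.1 h
    refine SimpleGraph.Dart.ext _ _ (Prod.ext (Subtype.ext ?_) (Subtype.ext ?_))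
    · exact (hk2 d).symm.trans ((congrArg G.att h').trans (hk2 d'))
    · exact (hk3 d).symm.trans ((congrArg (fun x => G.att (τ x)) h').trans (hk3 d'))
  have h1 := conn.card_vert_le_card_edgeSet_add_one
  have h2 := Γ.dart_card_eq_twice_card_edges
  rw [Nat.card_eq_fintype_card, Nat.card_eq_fintype_card, ← SimpleGraph.edgeFinset_card] at h1
  rw [htarget]
  obtain ⟨a, ha⟩ := evenS
  obtain ⟨b, hb⟩ := evenH
  omega

/-- Removing each vertex `v` with `ρ v = some π`, its four half-edges being joined in pairs
according to `π`, and keeping each vertex `v` with `ρ v = none`. -/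
def resolve (G : FramedGraph) (ρ : G.V → Option Pairing) : FramedGraph where
  V := {v : G.V // ρ v = none}
  E := Quot (G.Glue ρ)
  finV := inferInstance
  finE := Finite.of_surjective _ Quot.mk_surjective
  att h := Quot.mk _ (G.att (h.1.1, h.2))
  att_ncard := G.resolve_ncard ρ

/-- Isomorphism of framed 4-graphs: bijections of vertices, half-edges and edges that respect
incidence and opposite half-edges. -/
def Iso (G G' : FramedGraph) : Prop :=
  ∃ (φ : G.V ≃ G'.V) (ψ : G.V × Corner ≃ G'.V × Corner) (ε : G.E ≃ G'.E),
    (∀ h, (ψ h).1 = φ h.1) ∧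
    (∀ v c, (ψ (v, Corner.opp c)).2 = Corner.opp (ψ (v, c)).2) ∧
    ∀ h, G'.att (ψ h) = ε (G.att h)

/-- The vertices `u ≠ v` span a bigon: two edges join them, and the two edges are not opposite
at `u` and not opposite at `v`. -/
def IsBigon (G : FramedGraph) (u v : G.V) : Prop :=
  u ≠ v ∧ ∃ a b c d : Corner, a.1 ≠ b.1 ∧ c.1 ≠ d.1 ∧
    G.att (u, a) = G.att (v, c) ∧ G.att (u, b) = G.att (v, d)

open Classical in
/-- The result of the decreasing second Reidemeister move at a bigon with vertices `u`, `v`: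
both vertices disappear and the two strands are pulled apart. -/
noncomputable def pullApart (G : FramedGraph) (u v : G.V) : FramedGraph :=
  G.resolve fun x => if x = u ∨ x = v then some Pairing.through else none

/-- The disjoint union `G ⊔ ○` of a framed 4-graph and a circle. -/
def addCircle (G : FramedGraph) : FramedGraph where
  V := G.V
  E := Option G.E
  finV := G.finV
  finE := inferInstance
  att h := some (G.att h)
  att_ncard e := by
    cases e with
    | none => left; simp
    | some e => simpa using G.att_ncard e

end FramedGraph

/-- The relations between framed 4-graphs: isomorphic graphs are equal, the second Reidemeister
move, and `G ⊔ ○ = δ G` for non-empty `G`. -/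
def relators (R : Type*) [CommRing R] (δ : R) : Set (FramedGraph →₀ R) :=
  {x | ∃ G G' : FramedGraph, G.Iso G' ∧ x = Finsupp.single G 1 - Finsupp.single G' 1} ∪
  {x | ∃ (G : FramedGraph) (u v : G.V), G.IsBigon u v ∧
    x = Finsupp.single G 1 - Finsupp.single (G.pullApart u v) 1} ∪
  {x | ∃ G : FramedGraph, Nonempty G.E ∧
    x = Finsupp.single G.addCircle 1 - Finsupp.single G δ}

/-- The module `R𝔊_δ` of linear combinations of framed 4-graphs. -/
abbrev GraphModule (R : Type*) [CommRing R] (δ : R) :=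
  (FramedGraph →₀ R) ⧸ Submodule.span R (relators R δ)

/-- The class of a framed 4-graph in `R𝔊_δ`. -/
noncomputable def graphClass (R : Type*) [CommRing R] (δ : R) (G : FramedGraph) :
    GraphModule R δ :=
  (Submodule.span R (relators R δ)).mkQ (Finsupp.single G 1)

/-! ### Virtual link diagrams -/

/-- An oriented virtual link diagram, virtual crossings being disregarded (that is, up to the detour
move), given by its signed arrow (Gauss) diagram. There are `n` classical crossings with signs. A
*passage* `(v, o)` is one of the two times at which the link runs through the crossing `v`, above
for `o = true` and below for `o = false`; `next` sends a passage to the following passage along the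
orientation. There are `circles` further components without classical crossings. -/
structure LinkDiagram where
  n : ℕ
  sign : Fin n → ℤˣ
  next : Equiv.Perm (Fin n × Bool)
  circles : ℕ

namespace LinkDiagram

variable (L : LinkDiagram)

/-- An edge is either the arc from a passage to the next one, named by the former, or
a component without classical crossings. -/
abbrev Edge : Type := (Fin L.n × Bool) ⊕ Fin L.circles

/-- The edge along which the link leaves the crossing `v`, above if `o` and below if not. -/
def outEdge (v : Fin L.n) (o : Bool) : L.Edge := Sum.inl (v, o)

/-- The edge along which the link enters the crossing `v`, above if `o` and below if not. -/
def inEdge (v : Fin L.n) (o : Bool) : L.Edge := Sum.inl (L.next.symm (v, o))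

/-- A knot diagram is a diagram with exactly one unicursal component. -/
def IsKnot : Prop :=
  Nat.card (Quotient (Equiv.Perm.SameCycle.setoid L.next)) + L.circles = 1

/-- The writhe number. -/
def writhe : ℤ := ∑ v, (L.sign v : ℤ)

theorem graph_ncard (e : L.Edge) :
    {h : Fin L.n × Corner |
      (if h.2.2 then L.outEdge h.1 h.2.1 else L.inEdge h.1 h.2.1) = e}.ncard = 0 ∨
    {h : Fin L.n × Corner |
      (if h.2.2 then L.outEdge h.1 h.2.1 else L.inEdge h.1 h.2.1) = e}.ncard = 2 := by
  rcases e with p | i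
  · right
    have : {h : Fin L.n × Corner |
        (if h.2.2 then L.outEdge h.1 h.2.1 else L.inEdge h.1 h.2.1) = Sum.inl p} =
        {(p.1, p.2, true), ((L.next p).1, (L.next p).2, false)} := by
      ext ⟨v, o, d⟩
      cases d
      · simp [inEdge, Equiv.symm_apply_eq, Prod.ext_iff]
      · simp [outEdge, Prod.ext_iff]
    rw [this, Set.ncard_pair (by simp)]
  · left
    have : {h : Fin L.n × Corner |
        (if h.2.2 then L.outEdge h.1 h.2.1 else L.inEdge h.1 h.2.1) = Sum.inr i} = ∅ := by
      ext ⟨v, o, d⟩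
      cases d <;> simp [inEdge, outEdge]
    rw [this, Set.ncard_empty]

/-- The underlying framed 4-graph. The half-edge `(v, o, d)` belongs to the upper strand if `o` and
to the lower one if not, and it is outgoing if `d` and incoming if not. -/
def graph : FramedGraph where
  V := Fin L.n
  E := L.Edge
  finV := inferInstance
  finE := inferInstance
  att h := if h.2.2 then L.outEdge h.1 h.2.1 else L.inEdge h.1 h.2.1
  att_ncard := L.graph_ncard

end LinkDiagram

/-! ### States -/

/-- What a state does at a crossing: the smoothing that respects the orientation, the other
smoothing, or the graphical vertex. -/
inductive Resolution : Type
  | oriented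
  | disoriented
  | vertex
  deriving DecidableEq

instance : Fintype Resolution :=
  ⟨{.oriented, .disoriented, .vertex}, fun t => by cases t <;> decide⟩

/-- The oriented smoothing joins incoming half-edges to outgoing half-edges of the other strand, the
disoriented smoothing joins the two incoming half-edges and the two outgoing half-edges. -/
def Resolution.pairing : Resolution → Option Pairing
  | .oriented => some .parallel
  | .disoriented => some .turning
  | .vertex => none

/-- The framed 4-graph of a state of a diagram. -/
def LinkDiagram.stateGraph (L : LinkDiagram) (t : Fin L.n → Resolution) : FramedGraph :=
  L.graph.resolve fun v => (t v).pairing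

/-! ### Biquandles and colourings -/

/-- A biquandle structure on `X`; `circ x y` and `ast x y` are written `x ∘ y` and `x ∗ y`. -/
structure Biquandle (X : Type*) where
  circ : X → X → X
  ast : X → X → X
  diag : ∀ x, circ x x = ast x x
  ast_bijective : ∀ y, Function.Bijective fun x => ast x y
  circ_bijective : ∀ y, Function.Bijective fun x => circ x y
  switch_bijective : Function.Bijective fun p : X × X => (ast p.2 p.1, circ p.1 p.2)
  exchange₁ : ∀ x y z, circ (circ x z) (circ y z) = circ (circ x y) (ast z y)
  exchange₂ : ∀ x y z, ast (circ y z) (circ x z) = circ (ast y x) (ast z x)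
  exchange₃ : ∀ x y z, ast (ast z x) (ast y x) = ast (ast z y) (circ x y)

namespace LinkDiagram

variable (L : LinkDiagram) {X : Type*}

/-- The first colour at a crossing: it lies on the lower strand, on the incoming edge of a positive
and on the outgoing edge of a negative crossing. -/
def colX (f : L.Edge → X) (v : Fin L.n) : X :=
  if L.sign v = 1 then f (L.inEdge v false) else f (L.outEdge v false)

/-- The second colour at a crossing: it lies on the upper strand, on the outgoing edge of a positive
and on the incoming edge of a negative crossing. -/
def colY (f : L.Edge → X) (v : Fin L.n) : X :=
  if L.sign v = 1 then f (L.outEdge v true) else f (L.inEdge v true)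

/-- The colour on the remaining edge of the lower strand. -/
def colX' (f : L.Edge → X) (v : Fin L.n) : X :=
  if L.sign v = 1 then f (L.outEdge v false) else f (L.inEdge v false)

/-- The colour on the remaining edge of the upper strand. -/
def colY' (f : L.Edge → X) (v : Fin L.n) : X :=
  if L.sign v = 1 then f (L.inEdge v true) else f (L.outEdge v true)

/-- The crossing relations. Drawing a crossing with both strands running downwards, `x` and `y` are
the colours on its left and `y ∗ x`, `x ∘ y` are the colours on its right. -/
def IsColoring (B : Biquandle X) (f : L.Edge → X) : Prop :=
  ∀ v, L.colX' f v = B.circ (L.colX f v) (L.colY f v) ∧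
    L.colY' f v = B.ast (L.colY f v) (L.colX f v)

/-- The biquandle colourings of a diagram. -/
abbrev Coloring (B : Biquandle X) := {f : L.Edge → X // L.IsColoring B f}

end LinkDiagram

/-! ### The parity-biquandle bracket -/

/-- A sequence `β = (A, B, C, D, E, F)` of maps `X × X → R`. -/
structure Coeffs (X R : Type*) where
  A : X → X → R
  B : X → X → R
  C : X → X → R
  D : X → X → R
  E : X → X → R
  F : X → X → R

/-- The relations making `β`, `δ`, `w` a parity-biquandle bracket. -/
structure IsParityBiquandleBracket {X R : Type*} [CommRing R] (Q : Biquandle X)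
    (β : Coeffs X R) (δ : R) (w : Rˣ) : Prop where
  kink_pos : ∀ x, δ * β.A x x + β.B x x = w
  kink_neg : ∀ x, δ * β.D x x + β.E x x = (w⁻¹ : Rˣ)
  kink_C : ∀ x, β.C x x = 0
  kink_F : ∀ x, β.F x x = 0
  two_AF : ∀ x y, β.A x y * β.F x y = 0
  two_CD : ∀ x y, β.C x y * β.D x y = 0
  two_BF : ∀ x y, β.B x y * β.F x y = 0
  two_CE : ∀ x y, β.C x y * β.E x y = 0
  two_AD : ∀ x y, β.A x y * β.D x y = 1 - β.C x y * β.F x y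
  two_BE : ∀ x y, β.B x y * β.E x y = 1 - β.C x y * β.F x y
  two_δ : ∀ x y, δ * (β.A x y * β.D x y) = - (β.A x y * β.E x y) - β.B x y * β.D x y
  three : ∀ x y z,
    -- On each side of the third move, the first, second and third crossing have these colours.
    let l (P₁ P₂ P₃ : X → X → R) : R := P₁ x y * P₂ y z * P₃ (Q.circ x y) (Q.ast z y)
    let r (P₁ P₂ P₃ : X → X → R) : R :=
      P₁ x z * P₂ (Q.ast y x) (Q.ast z x) * P₃ (Q.circ x z) (Q.circ y z)
    l β.A β.A β.A + l β.C β.C β.A = r β.A β.A β.A + r β.A β.C β.C ∧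
    l β.A β.B β.B + l β.C β.B β.C = r β.B β.B β.A + r β.C β.B β.C ∧
    l β.B β.A β.B + l β.B β.C β.C = r β.B β.A β.B + r β.C β.C β.B ∧
    l β.A β.C β.A + l β.C β.A β.A = r β.C β.A β.A ∧
    l β.A β.A β.C = r β.A β.A β.C + r β.A β.C β.A ∧
    l β.A β.C β.B = r β.B β.B β.C + r β.C β.B β.A ∧
    l β.B β.C β.B + l β.B β.A β.C = r β.B β.A β.C ∧
    l β.A β.B β.C + l β.C β.B β.B = r β.B β.C β.A ∧
    l β.C β.A β.B = r β.B β.C β.B + r β.C β.A β.B ∧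
    l β.C β.C β.B = r β.B β.C β.C ∧
    l β.A β.C β.C = r β.C β.C β.A ∧
    l β.C β.A β.C = r β.C β.A β.C ∧
    l β.B β.C β.A = 0 ∧ l β.C β.B β.A = 0 ∧ l β.B β.B β.C = 0 ∧ l β.C β.C β.C = 0 ∧
    r β.A β.B β.C = 0 ∧ r β.A β.C β.B = 0 ∧ r β.C β.B β.B = 0 ∧ r β.C β.C β.C = 0 ∧
    l β.A β.A β.B = r β.A β.B β.A + r β.A β.A β.B + δ * r β.A β.B β.B + r β.B β.B β.B ∧
    r β.B β.A β.A = l β.B β.A β.A + l β.A β.B β.A + δ * l β.B β.B β.A + l β.B β.B β.B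

namespace LinkDiagram

variable (L : LinkDiagram)

/-- The skein coefficient of a resolution at a crossing: `A`, `B`, `C` at a positive and `D`, `E`, `F`
at a negative crossing stand for the oriented smoothing, the other smoothing and the vertex. -/
def skein {X R : Type*} (β : Coeffs X R) (f : L.Edge → X) (v : Fin L.n) : Resolution → R
  | .oriented => (if L.sign v = 1 then β.A else β.D) (L.colX f v) (L.colY f v)
  | .disoriented => (if L.sign v = 1 then β.B else β.E) (L.colX f v) (L.colY f v)
  | .vertex => (if L.sign v = 1 then β.C else β.F) (L.colX f v) (L.colY f v)

/-- The value of the parity-biquandle bracket at a colouring: the sum of the contributions of the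
`3 ^ n` states, times `w` to the power minus the writhe. -/
noncomputable def bracketValue {X R : Type*} [CommRing R] (β : Coeffs X R) (δ : R) (w : Rˣ)
    (f : L.Edge → X) : GraphModule R δ :=
  ((w ^ (-L.writhe) : Rˣ) : R) •
    ∑ t : Fin L.n → Resolution, (∏ v, L.skein β f v (t v)) • graphClass R δ (L.stateGraph t)

/-- The parity-biquandle bracket multiset: the values at all colourings, with multiplicities. -/
noncomputable def bracketMultiset {X R : Type*} [Finite X] [CommRing R] (Q : Biquandle X)
    (β : Coeffs X R) (δ : R) (w : Rˣ) : Multiset (GraphModule R δ) :=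
  letI : Fintype (L.Coloring Q) := Fintype.ofFinite _
  (Finset.univ : Finset (L.Coloring Q)).val.map fun f => L.bracketValue β δ w f.1

/-! ### The Gaussian parity and the parity bracket -/

/-- On the core circle of a knot diagram, `c` lies strictly between `a` and `b`: running from `a`
along the orientation one meets `c` before `b`. -/
def Between (a b c : Fin L.n × Bool) : Prop :=
  ∃ k : ℕ, 0 < k ∧ (L.next ^ k) a = c ∧ ∀ j : ℕ, 0 < j → j ≤ k → (L.next ^ j) a ≠ b

/-- The chords of the crossings `u` and `v` are linked: exactly one end of the chord of `u` lies
on the arc of the core circle from the upper to the lower end of the chord of `v`. -/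
def Linked (u v : Fin L.n) : Prop :=
  u ≠ v ∧ Xor (L.Between (v, true) (v, false) (u, true))
    (L.Between (v, true) (v, false) (u, false))

/-- The Gaussian parity: the number of chords linked with the chord of `v`, modulo 2. -/
noncomputable def gaussianParity (v : Fin L.n) : ZMod 2 :=
  (Nat.card {u : Fin L.n // L.Linked u v} : ZMod 2)

/-- `K_s`: the sum of the graphs obtained by smoothing, in either way, the crossings with
`s v = 1` and keeping those with `s v = 0`. -/
noncomputable def partialSmoothing (s : Fin L.n → ZMod 2) : GraphModule (ZMod 2) 0 :=
  ∑ t : Fin L.n → Resolution with ∀ v, t v = Resolution.vertex ↔ s v = 0,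
    graphClass (ZMod 2) 0 (L.stateGraph t)

/-- The parity bracket in `ℤ₂𝔊₀` of a diagram whose crossings have the parities `p`. -/
noncomputable def parityBracket (p : Fin L.n → ZMod 2) : GraphModule (ZMod 2) 0 :=
  ∑ s : Fin L.n → ZMod 2,
    (∏ v, if s v = 0 then p v else 1 - p v) • L.partialSmoothing s

end LinkDiagram

/-! ### The parity biquandle -/

/-- The biquandle `ℤ₂` with `x ∘ y = x ∗ y = x + 1`. -/
def parityBiquandle : Biquandle (ZMod 2) where
  circ x _ := x + 1
  ast x _ := x + 1
  diag _ := rfl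
  ast_bijective _ := (Equiv.addRight (1 : ZMod 2)).bijective
  circ_bijective _ := (Equiv.addRight (1 : ZMod 2)).bijective
  switch_bijective := by decide
  exchange₁ _ _ _ := rfl
  exchange₂ _ _ _ := rfl
  exchange₃ _ _ _ := rfl

/-- The coefficients over `ℤ₂`: `C` and `F` are 1 on pairs of distinct colours and 0 otherwise,
and `A`, `B`, `D`, `E` are 1 on pairs of equal colours and 0 otherwise. -/
def parityCoeffs : Coeffs (ZMod 2) (ZMod 2) where
  A x y := if x = y then 1 else 0
  B x y := if x = y then 1 else 0
  C x y := if x = y then 0 else 1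
  D x y := if x = y then 1 else 0
  E x y := if x = y then 1 else 0
  F x y := if x = y then 0 else 1

end ParityBiquandle

/-!
Both strands change colour at every classical crossing, so a colouring of a knot diagram by the
parity biquandle is an alternating labelling of the edges along the core circle. The core circle
runs through `2 n` passages, an even number, so there are exactly two such labellings
(`card_coloring`).

At a crossing `v` the two colours that enter the skein coefficient differ by the number of passages
strictly between the two passages of `v` (`colX_add_colY`). Modulo 2 this number is the Gaussian
parity of `v`: a chord linked with that of `v` has one end there, any other chord none or two
(`natCast_card_between`). Hence for either colouring the coefficients `C` and `F` are the parity of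
the crossing and the other four coefficients are its complement. The sum over the `3 ^ n` states
then becomes the parity bracket once the states are grouped by their set of graphical vertices
(`bracketValue_eq_parityBracket`).
-/

namespace ParityBiquandle

theorem isParityBiquandleBracket_parityCoeffs :
    IsParityBiquandleBracket parityBiquandle parityCoeffs 0 1 where
  kink_pos := by decide
  kink_neg := by decide
  kink_C := by decide
  kink_F := by decide
  two_AF := by decide
  two_CD := by decide
  two_BF := by decide
  two_CE := by decide
  two_AD := by decide
  two_BE := by decide
  two_δ := by decide
  three := by
    intro x y z
    dsimp only
    revert x y z
    decide

namespace LinkDiagram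

variable {L : LinkDiagram}

/-! ### Colourings as alternating labellings -/

/-- Crossing relations of either sign say that both strands change colour, because `b = a + 1` is
symmetric in `a` and `b` modulo 2. -/
theorem isColoring_parityBiquandle_iff {f : L.Edge → ZMod 2} :
    L.IsColoring parityBiquandle f ↔ ∀ p, f (Sum.inl (L.next p)) = f (Sum.inl p) + 1 := by
  have flip : ∀ a b : ZMod 2, a = b + 1 ↔ b = a + 1 := by decide
  constructor
  · intro h p
    obtain ⟨h1, h2⟩ := h (L.next p).1
    generalize hq : L.next p = q at h1 h2
    obtain rfl : p = L.next.symm q := by simp [← hq]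
    obtain ⟨v, o⟩ := q
    by_cases hs : L.sign v = 1 <;> cases o <;>
      simp_all [colX, colX', colY, colY', inEdge, outEdge, parityBiquandle]
  · intro h v
    have h' : ∀ o, f (L.outEdge v o) = f (L.inEdge v o) + 1 := fun o => by
      simpa [inEdge, outEdge] using h (L.next.symm (v, o))
    by_cases hs : L.sign v = 1 <;>
      simp [colX, colX', colY, colY', hs, parityBiquandle, h', add_assoc, CharTwo.add_self_eq_zero]

theorem apply_next_pow {f : L.Edge → ZMod 2} (hf : L.IsColoring parityBiquandle f)
    (p : Fin L.n × Bool) (k : ℕ) : f (Sum.inl ((L.next ^ k) p)) = f (Sum.inl p) + k := by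
  induction k with
  | zero => simp
  | succ k ih =>
    rw [pow_succ', Equiv.Perm.mul_apply, isColoring_parityBiquandle_iff.1 hf, ih]
    push_cast
    ring

/-! ### The core circle of a knot diagram -/

theorem IsKnot.isCycleOn (hL : L.IsKnot) :
    L.next.IsCycleOn (Finset.univ : Finset (Fin L.n × Bool)) := by
  refine ⟨by simp, fun a _ b _ => ?_⟩
  have h1 : Nat.card (Quotient (Equiv.Perm.SameCycle.setoid L.next)) ≤ 1 := by
    unfold IsKnot at hL
    omega
  have := (Finite.card_le_one_iff_subsingleton).1 h1
  exact Quotient.exact (s := Equiv.Perm.SameCycle.setoid L.next) (Subsingleton.elim _ _)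

theorem IsKnot.circles_eq_zero (hL : L.IsKnot) (a : Fin L.n × Bool) : L.circles = 0 := by
  have : Nonempty (Quotient (Equiv.Perm.SameCycle.setoid L.next)) := ⟨Quotient.mk _ a⟩
  have := Nat.card_pos (α := Quotient (Equiv.Perm.SameCycle.setoid L.next))
  unfold IsKnot at hL
  omega

theorem IsKnot.circles_eq_one (hL : L.IsKnot) [IsEmpty (Fin L.n × Bool)] : L.circles = 1 := by
  have : IsEmpty (Quotient (Equiv.Perm.SameCycle.setoid L.next)) :=
    ⟨fun q => Quotient.ind (motive := fun _ => False) isEmptyElim q⟩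
  simpa [IsKnot] using hL

/-! ### Counting the colourings -/

/-- The edges are coloured by their distance from a base point along the core circle, which is
well defined modulo 2 since the circle has `2 * L.n` passages. -/
theorem IsKnot.exists_isColoring (hL : L.IsKnot) :
    ∃ f : L.Edge → ZMod 2, L.IsColoring parityBiquandle f := by
  rcases isEmpty_or_nonempty (Fin L.n × Bool) with h | ⟨⟨a⟩⟩
  · exact ⟨0, isColoring_parityBiquandle_iff.2 fun p => isEmptyElim p⟩
  · have hc := hL.isCycleOn
    have hk : ∀ p, ∃ k : ℕ, (L.next ^ k) a = p := fun p =>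
      let ⟨k, _, h⟩ := hc.exists_pow_eq (Finset.mem_univ a) (Finset.mem_univ p)
      ⟨k, h⟩
    choose k hk using hk
    refine ⟨Sum.elim (fun p => (k p : ZMod 2)) 0, isColoring_parityBiquandle_iff.2 fun p => ?_⟩
    have h1 : (L.next ^ k (L.next p)) a = (L.next ^ (k p + 1)) a := by
      rw [hk, pow_succ', Equiv.Perm.mul_apply, hk]
    have h2 := (hc.pow_apply_eq_pow_apply (Finset.mem_univ a)).1 h1
    have h3 : k (L.next p) ≡ k p + 1 [MOD 2] := h2.of_dvd (by simp)
    simpa using (ZMod.natCast_eq_natCast_iff _ _ _).2 h3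

/-- A colouring of a knot diagram is determined by its colour on one edge, which is arbitrary. -/
theorem IsKnot.bijective_apply (hL : L.IsKnot) (e : L.Edge) :
    Function.Bijective fun f : L.Coloring parityBiquandle => f.1 e := by
  constructor
  · rintro ⟨f, hf⟩ ⟨g, hg⟩ (h : f e = g e)
    refine Subtype.ext (funext fun e' => ?_)
    change f e' = g e'
    rcases isEmpty_or_nonempty (Fin L.n × Bool) with h0 | ⟨⟨a⟩⟩
    · -- A diagram without classical crossings consists of a single edge.
      have h1 := hL.circles_eq_one
      have : Subsingleton (Fin L.circles) := by rw [h1]; infer_instance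
      rcases e with p | i
      · exact isEmptyElim p
      rcases e' with p | j
      · exact isEmptyElim p
      rwa [Subsingleton.elim j i]
    · have h1 := hL.circles_eq_zero a
      have : IsEmpty (Fin L.circles) := by rw [h1]; infer_instance
      rcases e with p | i
      swap
      · exact isEmptyElim i
      rcases e' with q | i
      swap
      · exact isEmptyElim i
      obtain ⟨k, -, rfl⟩ := hL.isCycleOn.exists_pow_eq (Finset.mem_univ p) (Finset.mem_univ q)
      rw [apply_next_pow hf, apply_next_pow hg, h]
  · intro c
    obtain ⟨f, hf⟩ := hL.exists_isColoring
    refine ⟨⟨fun e' => f e' + (c - f e), isColoring_parityBiquandle_iff.2 fun p => ?_⟩, by simp⟩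
    rw [isColoring_parityBiquandle_iff.1 hf]
    ring

theorem IsKnot.nonempty_edge (hL : L.IsKnot) : Nonempty L.Edge := by
  rcases isEmpty_or_nonempty (Fin L.n × Bool) with h | ⟨⟨a⟩⟩
  · exact ⟨Sum.inr ⟨0, by simp [hL.circles_eq_one]⟩⟩
  · exact ⟨Sum.inl a⟩

theorem IsKnot.card_coloring (hL : L.IsKnot) : Nat.card (L.Coloring parityBiquandle) = 2 := by
  obtain ⟨e⟩ := hL.nonempty_edge
  rw [Nat.card_eq_of_bijective _ (hL.bijective_apply e), Nat.card_zmod]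

/-! ### The Gaussian parity -/

theorem not_between_right (a b : Fin L.n × Bool) : ¬ L.Between a b b :=
  fun ⟨k, hk, h, h'⟩ => h' k hk le_rfl h

/-- For `d` less than the length of the core circle, the passages strictly between `a` and the
`d`-th passage after `a` are the first `d - 1` passages after `a`. -/
theorem IsKnot.between_iff (hL : L.IsKnot) {a c : Fin L.n × Bool} {d : ℕ}
    (hd : d < 2 * L.n) (hd0 : 0 < d) :
    L.Between a ((L.next ^ d) a) c ↔ ∃ k ∈ Finset.Ioo 0 d, (L.next ^ k) a = c := by
  constructor
  · rintro ⟨k, hk, rfl, h⟩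
    refine ⟨k, Finset.mem_Ioo.2 ⟨hk, ?_⟩, rfl⟩
    by_contra! hdk
    exact h d hd0 hdk rfl
  · rintro ⟨k, hk, rfl⟩
    rw [Finset.mem_Ioo] at hk
    refine ⟨k, hk.1, rfl, fun j hj hjk h => ?_⟩
    have h1 := (hL.isCycleOn.pow_apply_eq_pow_apply (Finset.mem_univ a)).1 h
    simp only [Finset.card_univ, Fintype.card_prod, Fintype.card_fin, Fintype.card_bool] at h1
    have := h1.eq_of_lt_of_lt (by omega) (by omega)
    omega

theorem IsKnot.card_between (hL : L.IsKnot) {a : Fin L.n × Bool} {d : ℕ}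
    (hd : d < 2 * L.n) (hd0 : 0 < d) :
    Nat.card {c // L.Between a ((L.next ^ d) a) c} = d - 1 := by
  have h : Set.InjOn (fun k => (L.next ^ k) a) (Finset.Ioo 0 d : Finset ℕ) := by
    intro i hi j hj hij
    have h1 := (hL.isCycleOn.pow_apply_eq_pow_apply (Finset.mem_univ a)).1 hij
    simp only [Finset.card_univ, Fintype.card_prod, Fintype.card_fin, Fintype.card_bool] at h1
    simp only [Finset.coe_Ioo, Set.mem_Ioo] at hi hj
    exact h1.eq_of_lt_of_lt (by omega) (by omega)
  have h2 : ∀ c, L.Between a ((L.next ^ d) a) c ↔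
      c ∈ (Finset.Ioo 0 d).image fun k => (L.next ^ k) a := fun c => by
    rw [hL.between_iff hd hd0, Finset.mem_image]
  rw [Nat.card_congr (Equiv.subtypeEquivRight h2), Nat.card_eq_fintype_card, Fintype.card_coe,
    Finset.card_image_of_injOn h, Nat.card_Ioo, Nat.sub_zero]

/-- The passages met from the upper to the lower passage of `v` are counted crossing by crossing. A
crossing whose chord is not linked with that of `v` contributes an even number. -/
theorem natCast_card_between (v : Fin L.n) (h : ¬ L.Between (v, true) (v, false) (v, true)) :
    (Nat.card {c // L.Between (v, true) (v, false) c} : ZMod 2) = L.gaussianParity v := by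
  classical
  rw [gaussianParity, Nat.card_eq_fintype_card, Nat.card_eq_fintype_card, Fintype.card_subtype,
    Fintype.card_subtype, Finset.natCast_card_filter, Finset.natCast_card_filter,
    Fintype.sum_prod_type]
  refine Finset.sum_congr rfl fun u _ => ?_
  have h' := L.not_between_right (v, true) (v, false)
  rw [Fintype.sum_bool]
  by_cases huv : u = v
  · subst huv
    simp [h, h', Linked]
  · by_cases h1 : L.Between (v, true) (v, false) (u, true) <;>
      by_cases h2 : L.Between (v, true) (v, false) (u, false) <;>
      simp [Linked, huv, h1, h2, Xor, CharTwo.add_self_eq_zero]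

/-- If the lower passage of `v` is the `d`-th after the upper one, the colour changes `d` times on
the way, and `d - 1` passages lie strictly in between. -/
theorem IsKnot.apply_lower (hL : L.IsKnot) {f : L.Edge → ZMod 2}
    (hf : L.IsColoring parityBiquandle f) (v : Fin L.n) :
    f (L.outEdge v false) = f (L.outEdge v true) + L.gaussianParity v + 1 := by
  obtain ⟨d, hd, h⟩ := hL.isCycleOn.exists_pow_eq (Finset.mem_univ (v, true))
    (Finset.mem_univ (v, false))
  replace hd : d < 2 * L.n := by simpa [mul_comm] using hd
  have hd0 : 0 < d := by
    rcases Nat.eq_zero_or_pos d with rfl | h0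
    · simp at h
    · exact h0
  have hv : ¬ L.Between (v, true) (v, false) (v, true) := by
    rw [← h, hL.between_iff hd hd0]
    rintro ⟨k, hk, h3⟩
    rw [Finset.mem_Ioo] at hk
    have h4 := (hL.isCycleOn.pow_apply_eq (Finset.mem_univ (v, true))).1 h3
    simp only [Finset.card_univ, Fintype.card_prod, Fintype.card_fin, Fintype.card_bool] at h4
    have := Nat.le_of_dvd hk.1 h4
    omega
  have hc := hL.card_between (a := (v, true)) hd hd0
  rw [h] at hc
  rw [← natCast_card_between v hv, hc]
  have := apply_next_pow hf (v, true) d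
  rw [h] at this
  rw [outEdge, outEdge, this, add_assoc]
  congr 1
  exact_mod_cast congrArg (Nat.cast (R := ZMod 2)) (Nat.sub_add_cancel hd0).symm

/-- For either sign, one of the two colours lies on an incoming and the other one on an outgoing
edge, which offsets the summand 1 of `IsKnot.apply_lower`. -/
theorem IsKnot.colX_add_colY (hL : L.IsKnot) {f : L.Edge → ZMod 2}
    (hf : L.IsColoring parityBiquandle f) (v : Fin L.n) :
    L.colX f v + L.colY f v = L.gaussianParity v := by
  have h' : ∀ o, f (L.outEdge v o) = f (L.inEdge v o) + 1 := fun o => by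
    simpa [inEdge, outEdge] using isColoring_parityBiquandle_iff.1 hf (L.next.symm (v, o))
  have h1 := hL.apply_lower hf v
  have h2 := h' true
  have h3 := h' false
  unfold colX colY
  generalize f (L.outEdge v true) = a at *
  generalize f (L.outEdge v false) = b at *
  generalize f (L.inEdge v true) = c at *
  generalize f (L.inEdge v false) = d at *
  generalize L.gaussianParity v = p at *
  split_ifs <;> revert a b c d p <;> decide

theorem skein_parityCoeffs (f : L.Edge → ZMod 2) (v : Fin L.n) (t : Resolution) :
    L.skein parityCoeffs f v t =
      if t = .vertex then L.colX f v + L.colY f v else 1 - (L.colX f v + L.colY f v) := by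
  cases t <;> by_cases hs : L.sign v = 1 <;> simp only [skein, hs, if_true, if_false] <;>
    generalize L.colX f v = x <;> generalize L.colY f v = y <;> revert x y <;> decide

/-! ### The bracket -/

/-- Each state `t` belongs to exactly one `s`, which records the vertices kept by `t`. -/
theorem parityBracket_eq_sum (p : Fin L.n → ZMod 2) :
    L.parityBracket p = ∑ t : Fin L.n → Resolution,
      (∏ v, if t v = .vertex then p v else 1 - p v) • graphClass (ZMod 2) 0 (L.stateGraph t) := by
  classical
  let σ (t : Fin L.n → Resolution) : Fin L.n → ZMod 2 := fun v => if t v = .vertex then 0 else 1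
  have hσ : ∀ t s, (∀ v, t v = Resolution.vertex ↔ s v = 0) ↔ σ t = s := by
    intro t s
    rw [funext_iff]
    refine forall_congr' fun v => ?_
    simp only [σ]
    generalize s v = x
    generalize t v = r
    revert x r
    decide
  rw [← Finset.sum_fiberwise_of_maps_to (g := σ) (t := Finset.univ) fun _ _ => Finset.mem_univ _]
  refine Finset.sum_congr rfl fun s _ => ?_
  rw [partialSmoothing, Finset.smul_sum]
  refine Finset.sum_congr (Finset.filter_congr fun t _ => hσ t s) fun t ht => ?_
  obtain rfl : σ t = s := (Finset.mem_filter.1 ht).2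
  congr 1
  refine Finset.prod_congr rfl fun v _ => ?_
  by_cases h : t v = .vertex <;> simp [σ, h]

theorem IsKnot.bracketValue_eq_parityBracket (hL : L.IsKnot) {f : L.Edge → ZMod 2}
    (hf : L.IsColoring parityBiquandle f) :
    L.bracketValue parityCoeffs 0 1 f = L.parityBracket L.gaussianParity := by
  rw [bracketValue, one_zpow, Units.val_one, one_smul, parityBracket_eq_sum]
  simp only [skein_parityCoeffs, hL.colX_add_colY hf]

end LinkDiagram

end ParityBiquandle

open ParityBiquandle in
theorem mainTheorem3 :
    IsParityBiquandleBracket parityBiquandle parityCoeffs 0 1 ∧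
    ∀ K : LinkDiagram, K.IsKnot →
      K.bracketMultiset parityBiquandle parityCoeffs 0 1 =
        {K.parityBracket K.gaussianParity, K.parityBracket K.gaussianParity} := by
  refine ⟨isParityBiquandleBracket_parityCoeffs, fun K hK => ?_⟩
  let _ : Fintype (K.Coloring parityBiquandle) := Fintype.ofFinite _
  rw [LinkDiagram.bracketMultiset,
    Multiset.map_congr rfl fun f _ => hK.bracketValue_eq_parityBracket f.2, Multiset.map_const',
    Finset.card_val, Finset.card_univ, ← Nat.card_eq_fintype_card, hK.card_coloring]
  rfl
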